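/- Let $\mathbb{D}$ be the open unit disc of $\mathbb{C}$ and let $dA = \frac{1}{\pi}\,dx\,dy$ be the normalized area measure on it. For an analytic function $f$ on $\mathbb{D}$, for $\alpha > -1$ and $0 < p < \infty$, put \[ \|f\|_{A^p_\alpha} = \left( (\alpha+1) \int_{\mathbb{D}} |f(z)|^p (1-|z|^2)^\alpha \, dA(z) \right)^{1/p}, \qquad \|f\|_{\mathcal{B}} = |f(0)| + \sup_{z \in \mathbb{D}} |f'(z)|(1-|z|^2) \] (the weighted Bergman norm and the Bloch norm, possibly $+\infty$), and let \[ C_\alpha(p) = \sup \left\{ \|f\|_{A^p_\alpha} : f \text{ analytic on } \mathbb{D},\ \|f\|_{\mathcal{B}} \le 1 \right\} \] be the norm of the inclusion of the Bloch space in the weighted Bergman space $A^p_\alpha$. Then for every $\alpha > -1$, \[ \liminf_{p \to \infty} \frac{C_\alpha(p)}{p} \ge \frac{1}{2e(\alpha+2)} \qquad\text{and}\qquad \limsup_{p \to \infty} \frac{C_\alpha(p)}{p} \le \frac{1}{2e\sqrt{(\alpha+1)(\alpha+2)}}, \] where $p$ tends to infinity through the real numbers. -/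

import Mathlib

open Filter MeasureTheory

noncomputable section

/-- The weighted area measure `(α + 1) (1 - |z|²)^α dA(z)` of the open unit disc, where
`dA = dx dy / π` is the normalized area measure. It is carried by the unit disc. -/
def bergmanMeasure (α : ℝ) : Measure ℂ :=
  (volume.restrict (Metric.ball (0 : ℂ) 1)).withDensity
    (fun z => ENNReal.ofReal ((α + 1) * (1 - ‖z‖ ^ 2) ^ α / Real.pi))

/-- The norm of `f` in the weighted Bergman space `A^p_α` (with value `∞` when `f` is an analytic
function that does not belong to the space), for `0 < p < ∞`. -/
def bergmanNorm (α p : ℝ) (f : ℂ → ℂ) : ENNReal :=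
  eLpNorm f (ENNReal.ofReal p) (bergmanMeasure α)

/-- The Bloch seminorm `sup_{|z| < 1} |f'(z)| (1 - |z|²)`, with value `∞` when unbounded. -/
def blochSeminorm (f : ℂ → ℂ) : ENNReal :=
  ⨆ z ∈ Metric.ball (0 : ℂ) 1, ENNReal.ofReal (‖deriv f z‖ * (1 - ‖z‖ ^ 2))

/-- The Bloch norm `|f(0)| + ρ(f)`, with value `∞` when the analytic function `f` does not belong
to the Bloch space. -/
def blochNorm (f : ℂ → ℂ) : ENNReal :=
  ENNReal.ofReal ‖f 0‖ + blochSeminorm f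

/-- The norm of the inclusion of the Bloch space in `A^p_α`: the supremum of the `A^p_α` norms of
the functions analytic in the unit disc whose Bloch norm is at most one. -/
def blochBergmanConst (α p : ℝ) : ENNReal :=
  ⨆ f ∈ {f : ℂ → ℂ | DifferentiableOn ℂ f (Metric.ball (0 : ℂ) 1) ∧ blochNorm f ≤ 1},
    bergmanNorm α p f

end

/-!
The upper bound comes from a Littlewood–Paley identity. For `g` analytic in a neighbourhood of the
closed disc and `μ = bergmanMeasure α`,
`∫ (1 - |z|²)² |g'|² dμ = (α + 2) ((α + 2) ∫ |z|² |g|² dμ - ∫ |g|² dμ)`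
(`integral_norm_deriv_sq_eq`). Green's formula would give it, but for `|g|²` it suffices to compare
Taylor coefficients: the monomials are orthogonal with respect to `μ`
(`hasSum_integral_norm_sq`), and their norms satisfy the Beta function recursion
(`bergmanMoment_succ`). For `f` in the unit ball of the Bloch space, take `g = f ^ (m + 1)`. Then
`(1 - |z|²) |f'| ≤ 1` bounds the left side by `(m + 1)² ∫ |f| ^ (2m) dμ`. On the right side `|z|²`
may be replaced by a constant `η < 1`, up to an error of geometric growth in `m`, because `f` is
bounded where `|z|² < η`. The even moments `E m = ∫ |f| ^ (2m) dμ` therefore satisfy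
`L E (m + 1) ≤ (m + 1)² E m + D b ^ (m + 1)` with `L` close to `(α + 1) (α + 2)`
(`integral_norm_pow_succ_le`), whence `E m ≤ K (m!)² / L ^ m` with `K` independent of `f`
(`le_factorial_sq_of_recursion`, `exists_bergmanNorm_even_le`). The `2m`-th root of this is
`m / (e √L)` asymptotically by Stirling's formula. As `μ` is a probability measure, the norm is
monotone in `p`, and real exponents reduce to even integers.

The lower bound comes from `½ log ((1 + z) / (1 - z))`, of Bloch norm one. On a disc of radius
comparable to `t` near the point `1` it is at least `½ log (1 / t)`, and the disc has measure at
least `c t ^ (α + 2)`. The choice `t = exp (-p / (α + 2))` gives the constant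
(`exists_le_blochBergmanConst`).
-/

/-! ### The weighted area measure: total mass, moments, rotation invariance -/

/-- The density of `bergmanMeasure α` with respect to Lebesgue measure, as a function of
`r = ‖z‖`. It vanishes for `1 ≤ r`, so that integrals over the disc become integrals over `ℂ`. -/
noncomputable def bergmanDensity (α r : ℝ) : ℝ :=
  (Set.Iio 1).indicator (fun r => (α + 1) * (1 - r ^ 2) ^ α / Real.pi) r

theorem bergmanDensity_nonneg {α : ℝ} (hα : -1 < α) {r : ℝ} (hr : 0 ≤ r) :
    0 ≤ bergmanDensity α r := by
  unfold bergmanDensity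
  refine Set.indicator_apply_nonneg fun h => ?_
  have h1 : r < 1 := h
  have : 0 ≤ (1 - r ^ 2) := by nlinarith
  have h2 : 0 ≤ α + 1 := by linarith
  positivity

theorem measurable_bergmanDensity (α : ℝ) : Measurable (bergmanDensity α) := by
  unfold bergmanDensity
  exact Measurable.indicator (by fun_prop) measurableSet_Iio

theorem bergmanMeasure_eq_withDensity (α : ℝ) :
    bergmanMeasure α = volume.withDensity fun z : ℂ => ENNReal.ofReal (bergmanDensity α ‖z‖) := by
  unfold bergmanMeasure
  rw [← withDensity_indicator measurableSet_ball]
  congr 1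
  ext z
  by_cases hz : ‖z‖ < 1 <;> simp [Set.indicator, bergmanDensity, hz]

theorem integral_bergmanMeasure {E : Type*} [NormedAddCommGroup E] [NormedSpace ℝ E] {α : ℝ}
    (hα : -1 < α) (g : ℂ → E) :
    ∫ z, g z ∂bergmanMeasure α = ∫ z, bergmanDensity α ‖z‖ • g z := by
  rw [bergmanMeasure_eq_withDensity, integral_withDensity_eq_integral_toReal_smul]
  · simp [ENNReal.toReal_ofReal (bergmanDensity_nonneg hα (norm_nonneg _))]
  · exact ((measurable_bergmanDensity α).comp measurable_norm).ennreal_ofReal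
  · simp

theorem integral_bergmanMeasure_norm {α : ℝ} (hα : -1 < α) (G : ℝ → ℝ) :
    ∫ z, G ‖z‖ ∂bergmanMeasure α =
      ∫ r in (0 : ℝ)..1, 2 * (α + 1) * r * (1 - r ^ 2) ^ α * G r := by
  rw [integral_bergmanMeasure hα]
  rw [integral_fun_norm_addHaar volume (fun r => bergmanDensity α r • G r),
    intervalIntegral.integral_of_le zero_le_one, integral_Ioc_eq_integral_Ioo]
  have h1 : (volume : Measure ℂ).real (Metric.ball 0 1) = Real.pi := by
    simp [Measure.real, Complex.volume_ball]
  rw [h1, Complex.finrank_real_complex, ← integral_smul,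
    nsmul_eq_mul, ← integral_const_mul]
  have : ∀ r : ℝ, ((2 : ℕ) : ℝ) * Real.pi • r ^ (2 - 1) • bergmanDensity α r • G r =
      (Set.Iio 1).indicator (fun r => 2 * (α + 1) * r * (1 - r ^ 2) ^ α * G r) r := by
    intro r
    by_cases hr : r < 1
    · simp [bergmanDensity, hr]
      field_simp
    · simp [bergmanDensity, hr]
  simp_rw [this]
  rw [setIntegral_indicator measurableSet_Iio, Set.Ioi_inter_Iio]

/-- The primitive `-(1 - r²)^(α+1)` of the radial density has a nonnegative derivative, which
settles integrability also when `α < 0`. -/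
theorem hasDerivAt_one_sub_sq_rpow {α r : ℝ} (hr : r ∈ Set.Ioo (0 : ℝ) 1) :
    HasDerivAt (fun r : ℝ => -(1 - r ^ 2) ^ (α + 1)) (2 * (α + 1) * r * (1 - r ^ 2) ^ α) r := by
  have h0 : (1 - r ^ 2 : ℝ) ≠ 0 := by nlinarith [hr.1, hr.2]
  have h1 : HasDerivAt (fun r : ℝ => 1 - r ^ 2) (-(2 * r)) r := by
    simpa using (hasDerivAt_pow 2 r).const_sub 1
  refine (h1.rpow_const (p := α + 1) (Or.inl h0)).neg.congr_deriv ?_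
  rw [add_sub_cancel_right]
  ring

theorem continuous_one_sub_sq_rpow {β : ℝ} (hβ : 0 ≤ β) :
    Continuous (fun r : ℝ => (1 - r ^ 2) ^ β) :=
  Continuous.rpow_const (by fun_prop) fun _ => Or.inr hβ

theorem integrableOn_radial_density {α : ℝ} (hα : -1 < α) :
    IntegrableOn (fun r : ℝ => 2 * (α + 1) * r * (1 - r ^ 2) ^ α) (Set.Ioc 0 1) := by
  refine intervalIntegral.integrableOn_deriv_of_nonneg
    (g := fun r : ℝ => -(1 - r ^ 2) ^ (α + 1))
    (continuous_one_sub_sq_rpow (by linarith)).neg.continuousOn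
    (fun r hr => hasDerivAt_one_sub_sq_rpow hr) fun r hr => ?_
  have : 0 ≤ (1 - r ^ 2) := by nlinarith [hr.1, hr.2]
  have h2 : 0 ≤ α + 1 := by linarith
  have := hr.1.le
  positivity

theorem integrable_bergmanDensity {α : ℝ} (hα : -1 < α) :
    Integrable (fun z : ℂ => bergmanDensity α ‖z‖) := by
  rw [integrable_fun_norm_addHaar volume (f := bergmanDensity α), Complex.finrank_real_complex]
  have h := ((integrableOn_radial_density hα).mono_set Set.Ioo_subset_Ioc_self).const_mul
    (1 / (2 * Real.pi))
  have h1 : (fun y => y ^ (2 - 1) • bergmanDensity α y) = (Set.Iio 1).indicator fun r =>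
      1 / (2 * Real.pi) * (2 * (α + 1) * r * (1 - r ^ 2) ^ α) := by
    ext r
    by_cases hr : r < 1
    · simp [bergmanDensity, hr]
      field_simp
    · simp [bergmanDensity, hr]
  rw [h1, IntegrableOn, integrable_indicator_iff measurableSet_Iio, IntegrableOn,
    Measure.restrict_restrict measurableSet_Iio, Set.inter_comm, Set.Ioi_inter_Iio]
  exact h

theorem isProbabilityMeasure_bergmanMeasure {α : ℝ} (hα : -1 < α) :
    IsProbabilityMeasure (bergmanMeasure α) := by
  have h1 : ∫ z : ℂ, bergmanDensity α ‖z‖ = 1 := by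
    have := integral_bergmanMeasure_norm hα (fun _ => 1)
    rw [integral_bergmanMeasure hα] at this
    simp only [smul_eq_mul, mul_one] at this
    rw [this, intervalIntegral.integral_eq_sub_of_hasDerivAt_of_le zero_le_one
      (f := fun r : ℝ => -(1 - r ^ 2) ^ (α + 1))
      (continuous_one_sub_sq_rpow (by linarith)).neg.continuousOn
      (fun r hr => hasDerivAt_one_sub_sq_rpow hr)]
    · have : α + 1 ≠ 0 := by linarith
      simp [Real.zero_rpow this]
    · rw [intervalIntegrable_iff_integrableOn_Ioc_of_le zero_le_one]
      exact integrableOn_radial_density hα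
  constructor
  rw [bergmanMeasure_eq_withDensity, withDensity_apply _ MeasurableSet.univ, setLIntegral_univ,
    ← ofReal_integral_eq_lintegral_ofReal (integrable_bergmanDensity hα)
      (Eventually.of_forall fun z : ℂ => bergmanDensity_nonneg hα (norm_nonneg z)), h1]
  simp

theorem ae_bergmanMeasure_mem_ball (α : ℝ) :
    ∀ᵐ z ∂bergmanMeasure α, z ∈ Metric.ball (0 : ℂ) 1 :=
  (withDensity_absolutelyContinuous _ _).ae_le (ae_restrict_mem measurableSet_ball)

theorem aestronglyMeasurable_bergmanMeasure (α : ℝ) {f : ℂ → ℂ}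
    (hf : ContinuousOn f (Metric.ball 0 1)) : AEStronglyMeasurable f (bergmanMeasure α) :=
  (hf.aestronglyMeasurable measurableSet_ball).mono_ac (withDensity_absolutelyContinuous _ _)

/-- The `k`-th moment of `‖z‖²` under `bergmanMeasure α`. -/
noncomputable def bergmanMoment (α : ℝ) (k : ℕ) : ℝ := ∫ z, ‖z‖ ^ (2 * k) ∂bergmanMeasure α

/-- The recursion of the Beta function, by integrating the derivative of
`r ^ (2k+2) (1 - r²)^(α+1)` over `[0, 1]`. -/
theorem bergmanMoment_succ {α : ℝ} (hα : -1 < α) (k : ℕ) :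
    (k + α + 2) * bergmanMoment α (k + 1) = (k + 1) * bergmanMoment α k := by
  have hi : ∀ n : ℕ, IntervalIntegrable
      (fun r : ℝ => 2 * (α + 1) * r * (1 - r ^ 2) ^ α * r ^ n) volume 0 1 := fun n =>
    ((intervalIntegrable_iff_integrableOn_Ioc_of_le zero_le_one).2
      (integrableOn_radial_density hα)).mul_continuousOn (by fun_prop)
  have hd : ∀ r ∈ Set.Ioo (0 : ℝ) 1,
      HasDerivAt (fun r : ℝ => r ^ (2 * k + 2) * (1 - r ^ 2) ^ (α + 1))
      (1 / (α + 1) * ((k + 1) * (2 * (α + 1) * r * (1 - r ^ 2) ^ α * r ^ (2 * k)) -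
        (k + α + 2) * (2 * (α + 1) * r * (1 - r ^ 2) ^ α * r ^ (2 * (k + 1))))) r := by
    intro r hr
    have h0 : (0 : ℝ) < 1 - r ^ 2 := by nlinarith [hr.1, hr.2]
    have h1 : HasDerivAt (fun r : ℝ => (1 - r ^ 2) ^ (α + 1))
        (-(2 * (α + 1) * r * (1 - r ^ 2) ^ α)) r := by
      simpa [Function.comp_def] using (hasDerivAt_one_sub_sq_rpow (α := α) hr).fun_neg
    refine ((hasDerivAt_pow (2 * k + 2) r).fun_mul h1).congr_deriv ?_
    have : α + 1 ≠ 0 := by linarith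
    simp only [Real.rpow_add h0, Real.rpow_one, show 2 * k + 2 - 1 = 2 * k + 1 by omega]
    push_cast
    field_simp
    ring
  have h := intervalIntegral.integral_eq_sub_of_hasDerivAt_of_le zero_le_one
    (by have := continuous_one_sub_sq_rpow (β := α + 1) (by linarith)
        fun_prop) hd ((((hi _).const_mul _).sub ((hi _).const_mul _)).const_mul _)
  rw [intervalIntegral.integral_const_mul, intervalIntegral.integral_sub ((hi _).const_mul _)
    ((hi _).const_mul _), intervalIntegral.integral_const_mul,
    intervalIntegral.integral_const_mul,
    ← integral_bergmanMeasure_norm hα (fun r => r ^ (2 * k)),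
    ← integral_bergmanMeasure_norm hα (fun r => r ^ (2 * (k + 1)))] at h
  have h2 : α + 1 ≠ 0 := by linarith
  simp only [one_pow, sub_self, Real.zero_rpow h2, mul_zero, ne_eq, Nat.add_eq_zero_iff,
    OfNat.ofNat_ne_zero, and_false, not_false_eq_true, zero_pow, zero_mul, mul_eq_zero,
    one_div, inv_eq_zero, h2, false_or] at h
  unfold bergmanMoment
  linarith

theorem measurePreserving_rotation_bergmanMeasure (α : ℝ) (u : Circle) :
    MeasurePreserving (rotation u) (bergmanMeasure α) (bergmanMeasure α) := by
  have h := (rotation u).measurePreserving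
  refine ⟨h.measurable, ?_⟩
  ext s hs
  have hm : Measurable fun z : ℂ => ENNReal.ofReal (bergmanDensity α ‖z‖) :=
    ((measurable_bergmanDensity α).comp measurable_norm).ennreal_ofReal
  rw [Measure.map_apply h.measurable hs, bergmanMeasure_eq_withDensity,
    withDensity_apply _ (h.measurable hs), withDensity_apply _ hs,
    ← h.setLIntegral_comp_preimage hs hm]
  simp only [LinearIsometryEquiv.norm_map]

open ComplexConjugate in
theorem integral_bergmanMeasure_pow_mul_conj_pow (α : ℝ) {k l : ℕ} (hkl : k ≠ l) (j : ℕ) :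
    ∫ z : ℂ, (‖z‖ : ℂ) ^ (2 * j) * (z ^ k * conj (z ^ l)) ∂bergmanMeasure α = 0 := by
  -- A rotation by one radian multiplies the integral by `exp (i (k - l)) ≠ 1`.
  set u : Circle := Circle.exp 1
  have h := (measurePreserving_rotation_bergmanMeasure α u).integral_comp
    (rotation u).toHomeomorph.measurableEmbedding
    (fun z : ℂ => (‖z‖ : ℂ) ^ (2 * j) * (z ^ k * conj (z ^ l)))
  have h1 : ∀ z : ℂ, (‖rotation u z‖ : ℂ) ^ (2 * j) *
      ((rotation u z) ^ k * conj ((rotation u z) ^ l)) =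
      ((u : ℂ) ^ k * conj ((u : ℂ) ^ l)) * ((‖z‖ : ℂ) ^ (2 * j) * (z ^ k * conj (z ^ l))) := by
    intro z
    rw [LinearIsometryEquiv.norm_map, rotation_apply, mul_pow, mul_pow, map_mul]
    ring
  simp only [h1] at h
  rw [integral_const_mul] at h
  have h2 : (u : ℂ) ^ k * conj ((u : ℂ) ^ l) ≠ 1 := by
    intro h3
    have h4 : (u : ℂ) ^ k * conj ((u : ℂ) ^ l) =
        Complex.exp (((k : ℝ) - l : ℝ) * Complex.I) := by
      simp only [u, Circle.coe_exp, ← Complex.exp_nat_mul, ← Complex.exp_conj, ← Complex.exp_add]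
      congr 1
      simp
      ring
    rw [h4, Complex.exp_eq_one_iff] at h3
    obtain ⟨n, hn⟩ := h3
    have h5 : ((k : ℝ) - l) = n * (2 * Real.pi) := by
      have := congrArg Complex.im hn
      simpa using this
    have hn0 : n ≠ 0 := by
      rintro rfl
      simp [sub_eq_zero] at h5
      exact hkl h5
    refine irrational_pi ⟨((k : ℚ) - l) / (2 * n), ?_⟩
    have : (n : ℝ) ≠ 0 := by exact_mod_cast hn0
    push_cast
    rw [h5]
    field_simp
  by_contra h3
  exact h2 (mul_right_cancel₀ h3 (h.trans (one_mul _).symm))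

/-! ### Parseval's identity and the Littlewood–Paley identity -/

open ComplexConjugate in
/-- Parseval's identity in the disc: the monomials are orthogonal for every radial weight. -/
theorem hasSum_integral_norm_sq {α : ℝ} (hα : -1 < α) {a : ℕ → ℂ}
    (ha : Summable fun k => ‖a k‖) {g : ℂ → ℂ}
    (hg : ∀ z ∈ Metric.ball (0 : ℂ) 1, g z = ∑' k, a k * z ^ k) (j : ℕ) :
    HasSum (fun k => ‖a k‖ ^ 2 * bergmanMoment α (k + j))
      (∫ z, ‖z‖ ^ (2 * j) * ‖g z‖ ^ 2 ∂bergmanMeasure α) := by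
  have := isProbabilityMeasure_bergmanMeasure hα
  set F : ℕ × ℕ → ℂ → ℂ := fun q z =>
    (‖z‖ : ℂ) ^ (2 * j) * ((a q.1 * z ^ q.1) * conj (a q.2 * z ^ q.2)) with hF
  have hb : ∀ q, ∀ᵐ z ∂bergmanMeasure α, ‖F q z‖ ≤ ‖a q.1‖ * ‖a q.2‖ := fun q => by
    filter_upwards [ae_bergmanMeasure_mem_ball α] with z hz
    have hz1 : ‖z‖ ≤ 1 := by simpa using (mem_ball_zero_iff.1 hz).le
    have h1 : ∀ n, ‖z‖ ^ n ≤ 1 := fun n => pow_le_one₀ (norm_nonneg _) hz1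
    simp only [hF, norm_mul, norm_pow, RCLike.norm_conj, Complex.norm_real, norm_norm]
    calc ‖z‖ ^ (2 * j) * (‖a q.1‖ * ‖z‖ ^ q.1 * (‖a q.2‖ * ‖z‖ ^ q.2))
        ≤ 1 * (‖a q.1‖ * 1 * (‖a q.2‖ * 1)) := by gcongr <;> exact h1 _
      _ = _ := by ring
  have hcont : ∀ q, Continuous (F q) := fun q => by
    simp only [hF]
    have := Complex.continuous_conj
    fun_prop
  have hi : ∀ q, Integrable (F q) (bergmanMeasure α) := fun q =>
    Integrable.of_bound (hcont q).aestronglyMeasurable _ (hb q)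
  have hs2 : Summable fun q : ℕ × ℕ => ‖a q.1‖ * ‖a q.2‖ :=
    ha.mul_of_nonneg ha (fun _ => norm_nonneg _) (fun _ => norm_nonneg _)
  have hs : Summable fun q => ∫ z, ‖F q z‖ ∂bergmanMeasure α := by
    refine Summable.of_nonneg_of_le (fun q => integral_nonneg fun z => norm_nonneg _)
      (fun q => ?_) hs2
    calc ∫ z, ‖F q z‖ ∂bergmanMeasure α
        ≤ ∫ z, ‖a q.1‖ * ‖a q.2‖ ∂bergmanMeasure α :=
          integral_mono_ae (hi q).norm (integrable_const _) (hb q)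
      _ = _ := by simp
  have key := hasSum_integral_of_summable_integral_norm hi hs
  have hsum : ∫ z, ∑' q, F q z ∂bergmanMeasure α =
      ((∫ z, ‖z‖ ^ (2 * j) * ‖g z‖ ^ 2 ∂bergmanMeasure α : ℝ) : ℂ) := by
    rw [← integral_complex_ofReal]
    refine integral_congr_ae ?_
    filter_upwards [ae_bergmanMeasure_mem_ball α] with z hz
    have hz1 : ‖z‖ ≤ 1 := by simpa using (mem_ball_zero_iff.1 hz).le
    have hsz : Summable fun k => ‖a k * z ^ k‖ :=
      Summable.of_nonneg_of_le (fun _ => norm_nonneg _) (fun k => by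
        rw [norm_mul, norm_pow]
        exact mul_le_of_le_one_right (norm_nonneg _) (pow_le_one₀ (norm_nonneg _) hz1)) ha
    have hszc : Summable fun k => ‖conj (a k * z ^ k)‖ := by simpa using hsz
    simp only [hF]
    rw [tsum_mul_left, ← tsum_mul_tsum_of_summable_norm hsz hszc, ← Complex.conj_tsum, ← hg z hz,
      Complex.mul_conj, Complex.normSq_eq_norm_sq]
    push_cast
    rfl
  have hval : ∀ q : ℕ × ℕ, ∫ z, F q z ∂bergmanMeasure α =
      if q.1 = q.2 then ((‖a q.1‖ ^ 2 * bergmanMoment α (q.1 + j) : ℝ) : ℂ) else 0 := by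
    rintro ⟨k, l⟩
    have h1 : ∀ z, F (k, l) z =
        (a k * conj (a l)) * ((‖z‖ : ℂ) ^ (2 * j) * (z ^ k * conj (z ^ l))) := fun z => by
      simp only [hF, map_mul]
      ring
    simp only [h1]
    rw [integral_const_mul]
    split_ifs with h
    · obtain rfl : k = l := h
      rw [Complex.mul_conj, Complex.normSq_eq_norm_sq, Complex.ofReal_mul, bergmanMoment,
        ← integral_complex_ofReal]
      congr 1
      refine integral_congr_ae (Eventually.of_forall fun z => ?_)
      simp only [Complex.mul_conj, Complex.normSq_eq_norm_sq, norm_pow]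
      push_cast
      ring
    · rw [integral_bergmanMeasure_pow_mul_conj_pow α h, mul_zero]
  rw [hsum] at key
  simp only [hval] at key
  have hinj : Function.Injective fun k : ℕ => (k, k) := fun a b h => (Prod.ext_iff.1 h).1
  rw [← hinj.hasSum_iff] at key
  · exact Complex.hasSum_ofReal.1 (by simpa [Function.comp_def] using key)
  · rintro ⟨k, l⟩ hkl
    rw [if_neg]
    intro h
    obtain rfl : k = l := h
    exact hkl ⟨k, rfl⟩

/-- The Littlewood–Paley identity for the monomial `z ^ (k + 1)`. -/
theorem bergmanMoment_identity {α : ℝ} (hα : -1 < α) (k : ℕ) :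
    ((k : ℝ) + 1) ^ 2 * (bergmanMoment α k - 2 * bergmanMoment α (k + 1) +
      bergmanMoment α (k + 2)) =
    (α + 2) * ((α + 2) * bergmanMoment α (k + 2) - bergmanMoment α (k + 1)) := by
  have h1 := bergmanMoment_succ hα k
  have h2 := bergmanMoment_succ hα (k + 1)
  push_cast at h2
  have hk : (0 : ℝ) ≤ k := k.cast_nonneg
  have h3 : (0 : ℝ) < k + 1 := by positivity
  have h4 : (k : ℝ) + 1 + α + 2 ≠ 0 := by linarith
  have e1 : bergmanMoment α k = (k + α + 2) * bergmanMoment α (k + 1) / (k + 1) := by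
    field_simp; linarith
  have e2 : bergmanMoment α (k + 2) =
      (k + 1 + 1) * bergmanMoment α (k + 1) / (k + 1 + α + 2) := by
    rw [eq_div_iff h4]; linarith
  rw [e1, e2]
  field_simp
  ring

/-- The Taylor coefficients are absolutely summable because the series converges at the point `1`
of the larger disc. -/
theorem summable_taylor_of_differentiableOn_ball {R : ℝ} (hR : 1 < R) {g : ℂ → ℂ}
    (hg : DifferentiableOn ℂ g (Metric.ball 0 R)) :
    (Summable fun k : ℕ => ‖((k.factorial : ℂ))⁻¹ * iteratedDeriv k g 0‖) ∧
      ∀ z ∈ Metric.ball (0 : ℂ) 1,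
        g z = ∑' k : ℕ, ((k.factorial : ℂ))⁻¹ * iteratedDeriv k g 0 * z ^ k := by
  constructor
  · have := (Complex.hasSum_taylorSeries_on_ball hg (z := 1) (by simpa using hR)).summable.norm
    simpa using this
  · intro z hz
    have := (Complex.hasSum_taylorSeries_on_ball hg
      (Metric.ball_subset_ball hR.le hz)).tsum_eq
    rw [← this]
    refine tsum_congr fun k => ?_
    simp only [sub_zero, smul_eq_mul]
    ring

theorem integrable_bergmanMeasure_of_continuousOn {α : ℝ} (hα : -1 < α) {h : ℂ → ℝ}
    (hh : ContinuousOn h (Metric.closedBall 0 1)) : Integrable h (bergmanMeasure α) := by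
  have := isProbabilityMeasure_bergmanMeasure hα
  obtain ⟨C, hC⟩ := (isCompact_closedBall (0 : ℂ) 1).exists_bound_of_continuousOn hh
  refine Integrable.of_bound (((hh.mono Metric.ball_subset_closedBall).aestronglyMeasurable
    measurableSet_ball).mono_ac (withDensity_absolutelyContinuous _ _)) C ?_
  filter_upwards [ae_bergmanMeasure_mem_ball α] with z hz
  exact hC z (Metric.ball_subset_closedBall hz)

/-- A Littlewood–Paley identity. It is Green's formula for `|g|²` and `(1 - |z|²)^(α+2)`; here
it follows by comparing Taylor coefficients. -/
theorem integral_norm_deriv_sq_eq {α : ℝ} (hα : -1 < α) {R : ℝ} (hR : 1 < R) {g : ℂ → ℂ}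
    (hg : DifferentiableOn ℂ g (Metric.ball 0 R)) :
    ∫ z, (1 - ‖z‖ ^ 2) ^ 2 * ‖deriv g z‖ ^ 2 ∂bergmanMeasure α =
      (α + 2) * ((α + 2) * ∫ z, ‖z‖ ^ 2 * ‖g z‖ ^ 2 ∂bergmanMeasure α -
        ∫ z, ‖g z‖ ^ 2 ∂bergmanMeasure α) := by
  have hg' := hg.deriv Metric.isOpen_ball
  obtain ⟨hs, he⟩ := summable_taylor_of_differentiableOn_ball hR hg
  obtain ⟨hs', he'⟩ := summable_taylor_of_differentiableOn_ball hR hg'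
  have hcl : Metric.closedBall (0 : ℂ) 1 ⊆ Metric.ball 0 R := Metric.closedBall_subset_ball hR
  have hc' := hg'.continuousOn.mono hcl
  have hi : ∀ j : ℕ, Integrable (fun z => ‖z‖ ^ (2 * j) * ‖deriv g z‖ ^ 2) (bergmanMeasure α) :=
    fun j => integrable_bergmanMeasure_of_continuousOn hα (by fun_prop)
  have hL : ∫ z, (1 - ‖z‖ ^ 2) ^ 2 * ‖deriv g z‖ ^ 2 ∂bergmanMeasure α =
      (∫ z, ‖z‖ ^ (2 * 0) * ‖deriv g z‖ ^ 2 ∂bergmanMeasure α) -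
      2 * (∫ z, ‖z‖ ^ (2 * 1) * ‖deriv g z‖ ^ 2 ∂bergmanMeasure α) +
      ∫ z, ‖z‖ ^ (2 * 2) * ‖deriv g z‖ ^ 2 ∂bergmanMeasure α := by
    rw [← integral_const_mul, ← integral_sub (hi 0) ((hi 1).const_mul 2), ← integral_add
      (by exact (hi 0).sub ((hi 1).const_mul 2)) (hi 2)]
    refine integral_congr_ae (Eventually.of_forall fun z => ?_)
    simp only
    ring
  have hcoef : ∀ k : ℕ, ‖((k.factorial : ℂ))⁻¹ * iteratedDeriv k (deriv g) 0‖ ^ 2 =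
      ((k : ℝ) + 1) ^ 2 * ‖(((k + 1).factorial : ℂ))⁻¹ * iteratedDeriv (k + 1) g 0‖ ^ 2 := by
    intro k
    rw [iteratedDeriv_succ', ← mul_pow]
    congr 1
    have h1 : (((k + 1 : ℕ) : ℂ)) ≠ 0 := by exact_mod_cast k.succ_ne_zero
    have h2 : ((k : ℝ) + 1) = ‖((k + 1 : ℕ) : ℂ)‖ := by rw [Complex.norm_natCast]; push_cast; rfl
    rw [h2, ← norm_mul, Nat.factorial_succ, Nat.cast_mul, mul_inv]
    congr 1
    field_simp
  have hD := ((hasSum_integral_norm_sq hα hs' he' 0).sub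
    ((hasSum_integral_norm_sq hα hs' he' 1).mul_left 2)).add
    (hasSum_integral_norm_sq hα hs' he' 2)
  have hG := (((hasSum_integral_norm_sq hα hs he 1).mul_left (α + 2)).sub
    (hasSum_integral_norm_sq hα hs he 0)).mul_left (α + 2)
  rw [← hasSum_nat_add_iff' 1] at hG
  have hzero : (α + 2) * bergmanMoment α 1 = bergmanMoment α 0 := by
    have := bergmanMoment_succ hα 0
    simpa using this
  -- The constant term of `g` contributes nothing; the term of degree `k + 1` of `g` corresponds to
  -- the term of degree `k` of `deriv g`.
  rw [hL, hD.unique (hG.congr_fun fun k => ?_)]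
  · rw [Finset.sum_range_one, zero_add, zero_add, mul_left_comm (α + 2) (‖_‖ ^ 2), hzero]
    simp
  · rw [hcoef]
    simp only [add_zero, add_assoc, Nat.reduceAdd]
    linear_combination ‖(((k + 1).factorial : ℂ))⁻¹ * iteratedDeriv (k + 1) g 0‖ ^ 2 *
      bergmanMoment_identity hα k

/-! ### Even moments on the unit ball of the Bloch space -/

theorem norm_zero_le_of_blochNorm_le_one {f : ℂ → ℂ} (hf : blochNorm f ≤ 1) : ‖f 0‖ ≤ 1 := by
  have h : ENNReal.ofReal ‖f 0‖ ≤ 1 := le_self_add.trans hf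
  exact ENNReal.ofReal_le_one.1 h

theorem norm_deriv_mul_le_of_blochNorm_le_one {f : ℂ → ℂ} (hf : blochNorm f ≤ 1) {z : ℂ}
    (hz : z ∈ Metric.ball (0 : ℂ) 1) : ‖deriv f z‖ * (1 - ‖z‖ ^ 2) ≤ 1 := by
  have h : ENNReal.ofReal (‖deriv f z‖ * (1 - ‖z‖ ^ 2)) ≤ 1 :=
    (le_iSup₂ (f := fun z (_ : z ∈ Metric.ball (0 : ℂ) 1) =>
      ENNReal.ofReal (‖deriv f z‖ * (1 - ‖z‖ ^ 2))) z hz).trans (le_add_self.trans hf)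
  exact ENNReal.ofReal_le_one.1 h

theorem norm_le_of_norm_deriv_mul_le {f : ℂ → ℂ} (hd : DifferentiableOn ℂ f (Metric.ball 0 1))
    (h0 : ‖f 0‖ ≤ 1) (hf : ∀ z ∈ Metric.ball (0 : ℂ) 1, ‖deriv f z‖ * (1 - ‖z‖ ^ 2) ≤ 1)
    {η : ℝ} (hη1 : η < 1) {z : ℂ} (hz : ‖z‖ ^ 2 < η) :
    ‖f z‖ ≤ 1 + 1 / (1 - η) := by
  have hη : 0 < η := (sq_nonneg _).trans_lt hz
  have hs : √η < 1 := by rw [Real.sqrt_lt' one_pos]; simpa using hη1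
  have hsub : Metric.ball (0 : ℂ) √η ⊆ Metric.ball 0 1 := Metric.ball_subset_ball hs.le
  have hz1 : z ∈ Metric.ball (0 : ℂ) √η := by
    rw [mem_ball_zero_iff]
    exact Real.lt_sqrt_of_sq_lt hz
  have h1 : 0 < 1 - η := by linarith
  have key := Convex.norm_image_sub_le_of_norm_deriv_le (𝕜 := ℂ) (f := f) (C := 1 / (1 - η))
    (fun x hx => hd.differentiableAt (Metric.isOpen_ball.mem_nhds (hsub hx)))
    (fun x hx => by
      have hx2 : ‖x‖ ^ 2 < η := by
        rw [mem_ball_zero_iff] at hx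
        exact (Real.lt_sqrt (norm_nonneg _)).1 hx
      rw [le_div_iff₀ h1]
      exact (mul_le_mul_of_nonneg_left (by linarith) (norm_nonneg _)).trans (hf x (hsub hx)))
    (convex_ball _ _) (Metric.mem_ball_self (Real.sqrt_pos.2 hη)) hz1
  have hz2 : ‖z‖ ≤ 1 := by simpa using (mem_ball_zero_iff.1 (hsub hz1)).le
  calc ‖f z‖ = ‖f 0 + (f z - f 0)‖ := by rw [add_sub_cancel]
    _ ≤ ‖f 0‖ + ‖f z - f 0‖ := norm_add_le _ _
    _ ≤ 1 + 1 / (1 - η) := by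
      refine add_le_add h0 (key.trans ?_)
      rw [sub_zero]
      exact mul_le_of_le_one_right (by positivity) hz2

/-- The Littlewood–Paley identity for `f ^ (m + 1)` bounds the even moments of `|f|` recursively.
The points with `‖z‖² < η` are treated apart, as `f` is bounded there. -/
theorem integral_norm_pow_succ_le {α : ℝ} (hα : -1 < α) {R : ℝ} (hR : 1 < R) {f : ℂ → ℂ}
    (hd : DifferentiableOn ℂ f (Metric.ball 0 R)) (h0 : ‖f 0‖ ≤ 1)
    (hf : ∀ z ∈ Metric.ball (0 : ℂ) 1, ‖deriv f z‖ * (1 - ‖z‖ ^ 2) ≤ 1)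
    {η : ℝ} (hη1 : η < 1) (m : ℕ) :
    (α + 2) * ((α + 2) * η - 1) * ∫ z, ‖f z‖ ^ (2 * (m + 1)) ∂bergmanMeasure α ≤
      ((m : ℝ) + 1) ^ 2 * ∫ z, ‖f z‖ ^ (2 * m) ∂bergmanMeasure α +
        (α + 2) ^ 2 * (1 + 1 / (1 - η)) ^ (2 * (m + 1)) := by
  have := isProbabilityMeasure_bergmanMeasure hα
  have hcl : Metric.closedBall (0 : ℂ) 1 ⊆ Metric.ball 0 R := Metric.closedBall_subset_ball hR
  have hb1 : Metric.ball (0 : ℂ) 1 ⊆ Metric.ball 0 R := Metric.ball_subset_ball hR.le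
  have hc := hd.continuousOn.mono hcl
  have hg : DifferentiableOn ℂ (fun z => f z ^ (m + 1)) (Metric.ball 0 R) := hd.pow _
  have key := integral_norm_deriv_sq_eq hα hR hg
  have hc' := (hg.deriv Metric.isOpen_ball).continuousOn.mono hcl
  set B := 1 + 1 / (1 - η)
  set E := ∫ z, ‖f z‖ ^ (2 * (m + 1)) ∂bergmanMeasure α
  set X := ∫ z, ‖z‖ ^ 2 * ‖f z ^ (m + 1)‖ ^ 2 ∂bergmanMeasure α
  have hE : ∫ z, ‖f z ^ (m + 1)‖ ^ 2 ∂bergmanMeasure α = E := by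
    simp only [E, norm_pow, ← pow_mul, mul_comm]
  have h1 : ∫ z, (1 - ‖z‖ ^ 2) ^ 2 * ‖deriv (fun z => f z ^ (m + 1)) z‖ ^ 2 ∂bergmanMeasure α ≤
      ((m : ℝ) + 1) ^ 2 * ∫ z, ‖f z‖ ^ (2 * m) ∂bergmanMeasure α := by
    rw [← integral_const_mul]
    refine integral_mono_ae (integrable_bergmanMeasure_of_continuousOn hα (by fun_prop))
      (integrable_bergmanMeasure_of_continuousOn hα (by fun_prop)) ?_
    filter_upwards [ae_bergmanMeasure_mem_ball α] with z hz
    have hda := hd.differentiableAt (Metric.isOpen_ball.mem_nhds (hb1 hz))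
    have h2 : deriv (fun z => f z ^ (m + 1)) z = ((m + 1 : ℕ) : ℂ) * f z ^ m * deriv f z := by
      simpa using (hda.hasDerivAt.fun_pow (m + 1)).deriv
    have h3 := hf z hz
    have hz1 : ‖z‖ < 1 := by simpa using hz
    have h4 : 0 ≤ ‖deriv f z‖ * (1 - ‖z‖ ^ 2) :=
      mul_nonneg (norm_nonneg _) (by nlinarith [norm_nonneg z])
    have h5 : (‖deriv f z‖ * (1 - ‖z‖ ^ 2)) ^ 2 ≤ 1 := pow_le_one₀ h4 h3
    rw [h2, norm_mul, norm_mul, Complex.norm_natCast, norm_pow]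
    push_cast
    calc _ = ((m : ℝ) + 1) ^ 2 * ‖f z‖ ^ (2 * m) * (‖deriv f z‖ * (1 - ‖z‖ ^ 2)) ^ 2 := by ring
      _ ≤ _ := mul_le_of_le_one_right (by positivity) h5
  have h2 : η * E ≤ X + B ^ (2 * (m + 1)) := by
    have hX : Integrable (fun z => ‖z‖ ^ 2 * ‖f z ^ (m + 1)‖ ^ 2) (bergmanMeasure α) :=
      integrable_bergmanMeasure_of_continuousOn hα (by fun_prop)
    calc η * E = ∫ z, η * ‖f z‖ ^ (2 * (m + 1)) ∂bergmanMeasure α := by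
          rw [integral_const_mul]
      _ ≤ ∫ z, (‖z‖ ^ 2 * ‖f z ^ (m + 1)‖ ^ 2 + B ^ (2 * (m + 1))) ∂bergmanMeasure α := by
          refine integral_mono (integrable_bergmanMeasure_of_continuousOn hα (by fun_prop))
            (hX.add (integrable_const _)) fun z => ?_
          simp only [norm_pow, ← pow_mul, mul_comm (m + 1) 2]
          have hp : 0 ≤ ‖f z‖ ^ (2 * (m + 1)) := by positivity
          have hq : 0 ≤ ‖z‖ ^ 2 * ‖f z‖ ^ (2 * (m + 1)) := by positivity
          have hB : 0 ≤ B := by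
            have : 0 < 1 - η := by linarith
            positivity
          have hB2 : 0 ≤ B ^ (2 * (m + 1)) := by positivity
          rcases lt_or_ge (‖z‖ ^ 2) η with h | h
          · have h3 := pow_le_pow_left₀ (norm_nonneg _)
              (norm_le_of_norm_deriv_mul_le (hd.mono hb1) h0 hf hη1 h) (2 * (m + 1))
            have : η * ‖f z‖ ^ (2 * (m + 1)) ≤ ‖f z‖ ^ (2 * (m + 1)) :=
              mul_le_of_le_one_left hp hη1.le
            linarith
          · have := mul_le_mul_of_nonneg_right h hp
            linarith
      _ = _ := by rw [integral_add hX (integrable_const _)]; simp [X]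
  rw [hE] at key
  rw [key] at h1
  nlinarith [mul_le_mul_of_nonneg_left h2 (sq_nonneg (α + 2))]

/-- The solution of a recursion `L E (m+1) ≤ (m+1)² E m + D b ^ (m+1)`: the inhomogeneous term
grows only geometrically and does not affect the rate `(m!)² / L ^ m`. -/
theorem le_factorial_sq_of_recursion {E : ℕ → ℝ} {L D b : ℝ} (hL : 0 < L) (hD : 0 ≤ D)
    (hb : 0 ≤ b) (hE0 : E 0 ≤ 1)
    (hE : ∀ m : ℕ, L * E (m + 1) ≤ ((m : ℝ) + 1) ^ 2 * E m + D * b ^ (m + 1)) (m : ℕ) :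
    E m ≤ (1 + D / L * Real.exp (b * L)) * ((m.factorial : ℝ) ^ 2 / L ^ m) := by
  have hbL : 0 ≤ b * L := by positivity
  have key : ∀ m : ℕ, E m * L ^ m / (m.factorial : ℝ) ^ 2 ≤
      1 + D / L * ∑ k ∈ Finset.range (m + 1), (b * L) ^ k / (k.factorial : ℝ) := by
    intro m
    induction m with
    | zero =>
      have : 0 ≤ D / L := by positivity
      simp
      linarith
    | succ m ih =>
      have hf1 : (1 : ℝ) ≤ (m + 1).factorial := by
        exact_mod_cast (m + 1).factorial_pos
      have h1 : E (m + 1) * L ^ (m + 1) / ((m + 1).factorial : ℝ) ^ 2 ≤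
          E m * L ^ m / (m.factorial : ℝ) ^ 2 +
            D / L * ((b * L) ^ (m + 1) / ((m + 1).factorial : ℝ) ^ 2) := by
        calc _ = (L * E (m + 1)) * (L ^ m / ((m + 1).factorial : ℝ) ^ 2) := by ring
          _ ≤ (((m : ℝ) + 1) ^ 2 * E m + D * b ^ (m + 1)) *
              (L ^ m / ((m + 1).factorial : ℝ) ^ 2) :=
            mul_le_mul_of_nonneg_right (hE m) (by positivity)
          _ = _ := by
            rw [Nat.factorial_succ]
            push_cast
            field_simp
            ring
      have h2 : (b * L) ^ (m + 1) / ((m + 1).factorial : ℝ) ^ 2 ≤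
          (b * L) ^ (m + 1) / ((m + 1).factorial : ℝ) := by
        gcongr
        nlinarith
      rw [Finset.sum_range_succ, mul_add]
      have h3 := mul_le_mul_of_nonneg_left h2 (show 0 ≤ D / L by positivity)
      linarith
  have h1 := (key m).trans (add_le_add_right (mul_le_mul_of_nonneg_left
    (Real.sum_le_exp_of_nonneg hbL (m + 1)) (show 0 ≤ D / L by positivity)) 1)
  rw [div_le_iff₀ (by positivity), ← le_div_iff₀ (by positivity)] at h1
  rwa [← mul_div_assoc]

/-- The `A^{2m}_α` norm on the unit ball of the Bloch space is at most
`(K (m!)² / L ^ m) ^ (1 / 2m)` with a constant `K` independent of `m` and of the function, for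
`L` as close to `(α + 1) (α + 2)` as desired. Dilations `z ↦ f (r z)` ensure that all integrals
are finite, and Fatou's lemma returns to `f`. -/
theorem exists_bergmanNorm_even_le {α : ℝ} (hα : -1 < α) {η : ℝ} (hη1 : η < 1)
    (hη : 0 < (α + 2) * η - 1) : ∃ K : ℝ, 0 < K ∧ ∀ m : ℕ, m ≠ 0 → ∀ f : ℂ → ℂ,
      DifferentiableOn ℂ f (Metric.ball 0 1) → blochNorm f ≤ 1 →
      bergmanNorm α (2 * m) f ≤ ENNReal.ofReal
        ((K * ((m.factorial : ℝ) ^ 2 / ((α + 2) * ((α + 2) * η - 1)) ^ m)) ^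
          ((2 * m : ℝ)⁻¹)) := by
  have := isProbabilityMeasure_bergmanMeasure hα
  set L := (α + 2) * ((α + 2) * η - 1)
  have hL : 0 < L := mul_pos (by linarith) hη
  set b := (1 + 1 / (1 - η)) ^ 2
  refine ⟨1 + (α + 2) ^ 2 / L * Real.exp (b * L), by positivity, fun m hm f hf hB => ?_⟩
  set r : ℕ → ℝ := fun n => 1 - 1 / ((n : ℝ) + 2)
  have hr0 : ∀ n, 0 < r n := fun n => by
    have : 1 / ((n : ℝ) + 2) < 1 := by
      rw [div_lt_one (by positivity)]
      linarith [n.cast_nonneg (α := ℝ)]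
    simp only [r]
    linarith
  have hr1 : ∀ n, r n < 1 := fun n => by
    have : 0 < 1 / ((n : ℝ) + 2) := by positivity
    simp only [r]
    linarith
  have hr : Tendsto r atTop (nhds 1) := by
    have : Tendsto (fun n : ℕ => 1 / ((n : ℝ) + 2)) atTop (nhds 0) :=
      tendsto_const_nhds.div_atTop (tendsto_atTop_add_const_right _ _ tendsto_natCast_atTop_atTop)
    simpa [r] using this.const_sub 1
  have hmem : ∀ n, ∀ z ∈ Metric.ball (0 : ℂ) (r n)⁻¹, (r n : ℂ) * z ∈ Metric.ball (0 : ℂ) 1 := by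
    intro n z hz
    rw [mem_ball_zero_iff] at hz ⊢
    rw [norm_mul, Complex.norm_real, Real.norm_of_nonneg (hr0 n).le]
    calc r n * ‖z‖ < r n * (r n)⁻¹ := mul_lt_mul_of_pos_left hz (hr0 n)
      _ = 1 := mul_inv_cancel₀ (hr0 n).ne'
  have hR : ∀ n, 1 < (r n)⁻¹ := fun n => (one_lt_inv₀ (hr0 n)).2 (hr1 n)
  have hdn : ∀ n, DifferentiableOn ℂ (fun z => f (r n * z)) (Metric.ball 0 (r n)⁻¹) := fun n =>
    hf.comp (by fun_prop) (hmem n)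
  have hsub : ∀ n, Metric.ball (0 : ℂ) 1 ⊆ Metric.ball 0 (r n)⁻¹ := fun n =>
    Metric.ball_subset_ball (hR n).le
  have hbn : ∀ n, ∀ z ∈ Metric.ball (0 : ℂ) 1,
      ‖deriv (fun z => f (r n * z)) z‖ * (1 - ‖z‖ ^ 2) ≤ 1 := by
    intro n z hz
    have h1 := norm_deriv_mul_le_of_blochNorm_le_one hB (hmem n z (hsub n hz))
    rw [norm_mul, Complex.norm_real, Real.norm_of_nonneg (hr0 n).le] at h1
    rw [deriv_comp_mul_left, norm_smul, Complex.norm_real, Real.norm_of_nonneg (hr0 n).le]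
    have hz1 : ‖z‖ < 1 := by simpa using hz
    have h2 : 0 ≤ 1 - ‖z‖ ^ 2 := by nlinarith [norm_nonneg z]
    have h3 : (r n * ‖z‖) ^ 2 ≤ ‖z‖ ^ 2 := by
      exact pow_le_pow_left₀ (mul_nonneg (hr0 n).le (norm_nonneg _))
        (mul_le_of_le_one_left (norm_nonneg _) (hr1 n).le) 2
    calc _ ≤ 1 * ‖deriv f (r n * z)‖ * (1 - ‖z‖ ^ 2) := by gcongr; exact (hr1 n).le
      _ ≤ ‖deriv f (r n * z)‖ * (1 - (r n * ‖z‖) ^ 2) := by rw [one_mul]; gcongr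
      _ ≤ 1 := h1
  have h0n : ∀ n, ‖(fun z => f (r n * z)) 0‖ ≤ 1 := fun n => by
    simpa using norm_zero_le_of_blochNorm_le_one hB
  have hmeas : ∀ n, AEStronglyMeasurable (fun z => f (r n * z)) (bergmanMeasure α) := fun n =>
    aestronglyMeasurable_bergmanMeasure α ((hdn n).continuousOn.mono (hsub n))
  have hfatou := Lp.eLpNorm_lim_le_liminf_eLpNorm (p := ENNReal.ofReal (2 * m)) hmeas f (by
    filter_upwards [ae_bergmanMeasure_mem_ball α] with z hz
    have h1 := (hf.differentiableAt (Metric.isOpen_ball.mem_nhds hz)).continuousAt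
    refine h1.tendsto.comp ?_
    have := ((Complex.continuous_ofReal.tendsto 1).comp hr).mul_const z
    simpa using this)
  refine hfatou.trans (liminf_le_of_le (by isBoundedDefault) fun c hc => ?_)
  obtain ⟨n, hn⟩ := hc.exists
  refine hn.trans ?_
  have hm0 : (0 : ℝ) < 2 * m := by positivity
  obtain ⟨C, hC⟩ := (isCompact_closedBall (0 : ℂ) 1).exists_bound_of_continuousOn
    ((hdn n).continuousOn.mono (Metric.closedBall_subset_ball (hR n)))
  have hmemLp : MemLp (fun z => f (r n * z)) (ENNReal.ofReal (2 * m)) (bergmanMeasure α) :=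
    MemLp.of_bound (hmeas n) C (by
      filter_upwards [ae_bergmanMeasure_mem_ball α] with z hz
      exact hC z (Metric.ball_subset_closedBall hz))
  rw [hmemLp.eLpNorm_eq_integral_rpow_norm (ENNReal.ofReal_pos.2 hm0).ne'
    ENNReal.ofReal_ne_top,
    ENNReal.toReal_ofReal hm0.le]
  refine ENNReal.ofReal_le_ofReal (Real.rpow_le_rpow (integral_nonneg fun z => by positivity) ?_
    (by positivity))
  have hpow : ∀ x : ℝ, x ^ (2 * m : ℝ) = x ^ (2 * m) := fun x => by
    rw [← Real.rpow_natCast]; push_cast; rfl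
  simp only [hpow]
  refine le_factorial_sq_of_recursion
    (E := fun m => ∫ z, ‖f (r n * z)‖ ^ (2 * m) ∂bergmanMeasure α) hL (by positivity)
    (by positivity) (by simp) (fun k => ?_) m
  have := integral_norm_pow_succ_le hα (hR n) (hdn n) (h0n n) (hbn n) hη1 k
  rwa [pow_mul (1 + 1 / (1 - η))] at this

/-! ### The upper bound -/

theorem blochBergmanConst_mono {α : ℝ} (hα : -1 < α) {p q : ℝ} (hpq : p ≤ q) :
    blochBergmanConst α p ≤ blochBergmanConst α q := by
  have := isProbabilityMeasure_bergmanMeasure hα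
  refine iSup₂_mono fun f hf => ?_
  exact eLpNorm_le_eLpNorm_of_exponent_le (ENNReal.ofReal_le_ofReal hpq)
    (aestronglyMeasurable_bergmanMeasure α hf.1.continuousOn)

/-- The `n`-th root form of Stirling's formula. -/
theorem tendsto_log_factorial_div_sub_log :
    Tendsto (fun n : ℕ => Real.log n.factorial / n - Real.log n) atTop (nhds (-1)) := by
  have h1 : Tendsto (fun n : ℕ => Real.log (Stirling.stirlingSeq n)) atTop
      (nhds (Real.log √Real.pi)) :=
    (Real.continuousAt_log (by positivity)).tendsto.comp Stirling.tendsto_stirlingSeq_sqrt_pi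
  have h2 : Tendsto (fun n : ℕ => Real.log (Stirling.stirlingSeq n) / n) atTop (nhds 0) :=
    h1.div_atTop tendsto_natCast_atTop_atTop
  have h3 : Tendsto (fun n : ℕ => Real.log n / n) atTop (nhds 0) :=
    (Real.isLittleO_log_id_atTop.tendsto_div_nhds_zero).comp tendsto_natCast_atTop_atTop
  have h4 : Tendsto (fun n : ℕ => Real.log 2 / n) atTop (nhds 0) :=
    tendsto_const_nhds.div_atTop tendsto_natCast_atTop_atTop
  have h5 := (h2.add ((h3.add h4).const_mul (1 / 2))).sub_const 1
  norm_num at h5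
  refine h5.congr' ?_
  filter_upwards [eventually_gt_atTop 0] with n hn
  have hn0 : (0 : ℝ) < n := by exact_mod_cast hn
  rw [Stirling.log_stirlingSeq_formula, Real.log_mul two_ne_zero hn0.ne',
    Real.log_div hn0.ne' (Real.exp_pos 1).ne', Real.log_exp]
  field_simp
  ring

theorem tendsto_factorial_sq_root {K L : ℝ} (hK : 0 < K) (hL : 0 < L) :
    Tendsto (fun m : ℕ => (K * ((m.factorial : ℝ) ^ 2 / L ^ m)) ^ ((2 * m : ℝ)⁻¹) / m) atTop
      (nhds (1 / (Real.exp 1 * √L))) := by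
  have h1 : Tendsto (fun n : ℕ => Real.log K / 2 / n) atTop (nhds 0) :=
    tendsto_const_nhds.div_atTop tendsto_natCast_atTop_atTop
  have h2 := (Real.continuous_exp.tendsto _).comp
    ((tendsto_log_factorial_div_sub_log.add h1).sub_const (Real.log √L))
  have h3 : Real.exp (-1 + 0 - Real.log √L) = 1 / (Real.exp 1 * √L) := by
    rw [add_zero, Real.exp_sub, Real.exp_log (by positivity), Real.exp_neg]
    field_simp
  rw [h3] at h2
  refine h2.congr' ?_
  filter_upwards [eventually_gt_atTop 0] with n hn
  have hn0 : (0 : ℝ) < n := by exact_mod_cast hn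
  have hf : (0 : ℝ) < n.factorial := by exact_mod_cast n.factorial_pos
  have h4 : 0 < (K * ((n.factorial : ℝ) ^ 2 / L ^ n)) ^ ((2 * n : ℝ)⁻¹) / n := by positivity
  rw [← Real.exp_log h4]
  simp only [Function.comp_apply]
  congr 1
  rw [Real.log_div (by positivity) hn0.ne', Real.log_rpow (by positivity),
    Real.log_mul hK.ne' (by positivity), Real.log_div (by positivity) (by positivity),
    Real.log_pow, Real.log_pow, Real.log_sqrt hL.le]
  field_simp
  push_cast
  ring

theorem limsup_blochBergmanConst_le_of_lt {α : ℝ} (hα : -1 < α) {η : ℝ} (hη1 : η < 1)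
    (hη : 0 < (α + 2) * η - 1) :
    limsup (fun p : ℝ => blochBergmanConst α p / ENNReal.ofReal p) atTop ≤
      ENNReal.ofReal (1 / (2 * Real.exp 1 * √((α + 2) * ((α + 2) * η - 1)))) := by
  obtain ⟨K, hK, hb⟩ := exists_bergmanNorm_even_le hα hη1 hη
  set L := (α + 2) * ((α + 2) * η - 1)
  have hL : 0 < L := mul_pos (by linarith) hη
  set h : ℕ → ℝ := fun m => (K * ((m.factorial : ℝ) ^ 2 / L ^ m)) ^ ((2 * m : ℝ)⁻¹)
  -- The exponent `p` is compared with the least even integer `2 * ⌈p / 2⌉` above it.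
  have hhalf : Tendsto (fun p : ℝ => p / 2) atTop atTop := tendsto_id.atTop_div_const two_pos
  have hlim : Tendsto (fun p : ℝ => h ⌈p / 2⌉₊ / p) atTop
      (nhds (1 / (2 * Real.exp 1 * √L))) := by
    have h1 := (tendsto_factorial_sq_root hK hL).comp (tendsto_nat_ceil_atTop.comp hhalf)
    have h2 := ((tendsto_nat_ceil_div_atTop (R := ℝ)).comp hhalf).mul_const (1 / 2)
    have h3 := h1.mul h2
    have e : 1 / (Real.exp 1 * √L) * (1 * (1 / 2)) = 1 / (2 * Real.exp 1 * √L) := by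
      field_simp
    rw [e] at h3
    refine h3.congr' ?_
    filter_upwards [eventually_gt_atTop 0] with p hp
    have hm : (0 : ℝ) < (⌈p / 2⌉₊ : ℝ) := by exact_mod_cast Nat.ceil_pos.2 (half_pos hp)
    simp only [Function.comp_apply, h]
    field_simp
  have hlim' := (ENNReal.continuous_ofReal.tendsto _).comp hlim
  rw [← hlim'.limsup_eq]
  refine limsup_le_limsup ?_
  filter_upwards [eventually_gt_atTop 0] with p hp
  have hm : ⌈p / 2⌉₊ ≠ 0 := (Nat.ceil_pos.2 (half_pos hp)).ne'
  have h1 : p ≤ 2 * (⌈p / 2⌉₊ : ℝ) := by linarith [Nat.le_ceil (p / 2)]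
  rw [Function.comp_apply, ENNReal.ofReal_div_of_pos hp]
  gcongr
  refine (blochBergmanConst_mono hα h1).trans (iSup₂_le fun f hf => ?_)
  exact hb _ hm f hf.1 hf.2

theorem limsup_blochBergmanConst_le {α : ℝ} (hα : -1 < α) :
    limsup (fun p : ℝ => blochBergmanConst α p / ENNReal.ofReal p) atTop ≤
      ENNReal.ofReal (1 / (2 * Real.exp 1 * √((α + 1) * (α + 2)))) := by
  have hL : 0 < (α + 1) * (α + 2) := mul_pos (by linarith) (by linarith)
  have hc : ContinuousAt (fun η : ℝ =>
      1 / (2 * Real.exp 1 * √((α + 2) * ((α + 2) * η - 1)))) 1 := by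
    refine ContinuousAt.div (by fun_prop) (by fun_prop) ?_
    have : 0 < (α + 2) * ((α + 2) * 1 - 1) := by nlinarith
    positivity
  have h1 := ((ENNReal.continuous_ofReal.continuousAt.comp hc).tendsto).mono_left
    (nhdsWithin_le_nhds (s := Set.Iio 1))
  have h2 : (α + 2) * ((α + 2) * 1 - 1) = (α + 1) * (α + 2) := by ring
  simp only [Function.comp_def, h2] at h1
  refine ge_of_tendsto h1 ?_
  have h3 : ∀ᶠ η : ℝ in nhds 1, 0 < (α + 2) * η - 1 :=
    ContinuousAt.eventually_lt (by fun_prop) (by fun_prop) (by linarith)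
  filter_upwards [self_mem_nhdsWithin, nhdsWithin_le_nhds h3] with η hη1 hη
  exact limsup_blochBergmanConst_le_of_lt hα hη1 hη

/-! ### The lower bound -/

/-- The function `½ log ((1 + z) / (1 - z))`, with derivative `1 / (1 - z²)`. On the unit disc
`1 + z` and `1 - z` have positive real part, so principal logarithms are analytic there. -/
noncomputable def halfLogRatio (z : ℂ) : ℂ := (Complex.log (1 + z) - Complex.log (1 - z)) / 2

theorem hasDerivAt_halfLogRatio {z : ℂ} (hz : z ∈ Metric.ball (0 : ℂ) 1) :
    HasDerivAt halfLogRatio (1 / (1 - z ^ 2)) z := by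
  rw [mem_ball_zero_iff] at hz
  have hz' : ‖-z‖ < 1 := by rwa [norm_neg]
  have h1 := Complex.mem_slitPlane_of_norm_lt_one hz
  have h2 := Complex.mem_slitPlane_of_norm_lt_one hz'
  rw [← sub_eq_add_neg] at h2
  have h3 := ((((hasDerivAt_id z).const_add 1).clog h1).sub
    (((hasDerivAt_id z).const_sub 1).clog h2)).div_const 2
  refine h3.congr_deriv ?_
  have e1 := Complex.slitPlane_ne_zero h1
  have e2 := Complex.slitPlane_ne_zero h2
  have e3 : 1 - z ^ 2 ≠ 0 := by
    rw [show 1 - z ^ 2 = (1 + z) * (1 - z) by ring]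
    exact mul_ne_zero e1 e2
  simp only [id_eq]
  field_simp
  ring

theorem blochNorm_halfLogRatio_le : blochNorm halfLogRatio ≤ 1 := by
  have h0 : halfLogRatio 0 = 0 := by simp [halfLogRatio]
  rw [blochNorm, h0, norm_zero, ENNReal.ofReal_zero, zero_add]
  refine iSup₂_le fun z hz => ENNReal.ofReal_le_one.2 ?_
  rw [(hasDerivAt_halfLogRatio hz).deriv, norm_div, norm_one, one_div]
  rw [mem_ball_zero_iff] at hz
  have h1 : 0 < 1 - ‖z‖ ^ 2 := by nlinarith [norm_nonneg z]
  have h2 : 1 - ‖z‖ ^ 2 ≤ ‖1 - z ^ 2‖ := by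
    have := norm_sub_norm_le (1 : ℂ) (z ^ 2)
    rwa [norm_one, norm_pow] at this
  rw [inv_mul_le_one₀ (h1.trans_le h2)]
  exact h2

/-- The disc has area comparable to `t ^ 2`, and its points are at a distance comparable to `t`
from the unit circle, so that the weight there is comparable to `t ^ α`. -/
theorem exists_le_bergmanMeasure_ball {α : ℝ} (hα : -1 < α) : ∃ c : ℝ, 0 < c ∧ ∀ t : ℝ,
    0 < t → t ≤ 1 → ENNReal.ofReal (c * t ^ (α + 2)) ≤
      bergmanMeasure α (Metric.ball ((1 - t / 2 : ℝ) : ℂ) (t / 4)) := by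
  set κ : ℝ := min ((1 / 4) ^ α) (2 ^ α)
  have hκ : 0 < κ := lt_min (by positivity) (by positivity)
  have hα1 : 0 < α + 1 := by linarith
  refine ⟨(α + 1) * κ / 16, by positivity, fun t ht ht1 => ?_⟩
  set S := Metric.ball ((1 - t / 2 : ℝ) : ℂ) (t / 4)
  have hdens : ∀ z ∈ S, (α + 1) * (κ * t ^ α) / Real.pi ≤ bergmanDensity α ‖z‖ := by
    intro z hz
    have h1 : ‖z - ((1 - t / 2 : ℝ) : ℂ)‖ < t / 4 := mem_ball_iff_norm.1 hz
    have h2 := abs_norm_sub_norm_le z ((1 - t / 2 : ℝ) : ℂ)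
    rw [Complex.norm_real, Real.norm_of_nonneg (by linarith)] at h2
    have h3 := abs_le.1 (h2.trans h1.le)
    have hz1 : ‖z‖ < 1 := by linarith
    have hlo : t / 4 ≤ 1 - ‖z‖ ^ 2 := by nlinarith [norm_nonneg z]
    have hhi : 1 - ‖z‖ ^ 2 ≤ 2 * t := by nlinarith [norm_nonneg z]
    have h4 : κ * t ^ α ≤ (1 - ‖z‖ ^ 2) ^ α := by
      rcases le_total 0 α with h | h
      · calc κ * t ^ α ≤ (1 / 4) ^ α * t ^ α := by gcongr; exact min_le_left _ _
          _ = (t / 4) ^ α := by rw [← Real.mul_rpow (by norm_num) ht.le]; ring_nf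
          _ ≤ _ := Real.rpow_le_rpow (by positivity) hlo h
      · calc κ * t ^ α ≤ 2 ^ α * t ^ α := by gcongr; exact min_le_right _ _
          _ = (2 * t) ^ α := (Real.mul_rpow (by norm_num) ht.le).symm
          _ ≤ _ := Real.rpow_le_rpow_of_nonpos (by linarith) hhi h
    rw [bergmanDensity, Set.indicator_of_mem (by exact hz1)]
    gcongr
  rw [bergmanMeasure_eq_withDensity, withDensity_apply _ measurableSet_ball]
  calc ENNReal.ofReal ((α + 1) * κ / 16 * t ^ (α + 2))
      = ENNReal.ofReal ((α + 1) * (κ * t ^ α) / Real.pi) * volume S := by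
        rw [Complex.volume_ball, ← ENNReal.ofReal_pow (by positivity),
          ← ENNReal.ofReal_coe_nnreal, NNReal.coe_real_pi, ← ENNReal.ofReal_mul (by positivity),
          ← ENNReal.ofReal_mul (by positivity), Real.rpow_add ht, Real.rpow_two]
        congr 1
        field_simp
        norm_num
    _ = ∫⁻ z in S, ENNReal.ofReal ((α + 1) * (κ * t ^ α) / Real.pi) := by
        rw [setLIntegral_const]
    _ ≤ _ := setLIntegral_mono' measurableSet_ball fun z hz =>
        ENNReal.ofReal_le_ofReal (hdens z hz)

theorem le_norm_halfLogRatio {t : ℝ} (ht : 0 < t) (ht1 : t ≤ 1) {z : ℂ}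
    (hz : z ∈ Metric.ball ((1 - t / 2 : ℝ) : ℂ) (t / 4)) :
    Real.log (1 / t) / 2 ≤ ‖halfLogRatio z‖ := by
  have h1 : ‖z - ((1 - t / 2 : ℝ) : ℂ)‖ < t / 4 := mem_ball_iff_norm.1 hz
  have h2 : ‖1 - z‖ ≤ t := by
    calc ‖1 - z‖ = ‖((t / 2 : ℝ) : ℂ) - (z - ((1 - t / 2 : ℝ) : ℂ))‖ := by
          congr 1; push_cast; ring
      _ ≤ ‖((t / 2 : ℝ) : ℂ)‖ + ‖z - ((1 - t / 2 : ℝ) : ℂ)‖ := norm_sub_le _ _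
      _ ≤ t := by rw [Complex.norm_real, Real.norm_of_nonneg (by linarith)]; linarith
  have h3 : 1 ≤ ‖1 + z‖ := by
    have := norm_sub_le (1 + z) (-(1 - z))
    rw [norm_neg, show 1 + z - -(1 - z) = (2 : ℂ) by ring, Complex.norm_two] at this
    linarith
  have h4 : 0 < ‖1 - z‖ := by
    rw [norm_pos_iff, sub_ne_zero]
    rintro rfl
    have e : (1 : ℂ) - ((1 - t / 2 : ℝ) : ℂ) = ((t / 2 : ℝ) : ℂ) := by push_cast; ring
    rw [e, Complex.norm_real, Real.norm_of_nonneg (by linarith)] at h1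
    linarith
  have h5 : (halfLogRatio z).re = (Real.log ‖1 + z‖ - Real.log ‖1 - z‖) / 2 := by
    rw [halfLogRatio, Complex.div_ofNat_re, Complex.sub_re, Complex.log_re, Complex.log_re]
  refine le_trans ?_ ((le_abs_self _).trans (Complex.abs_re_le_norm _))
  rw [h5, one_div, Real.log_inv]
  linarith [Real.log_nonneg h3, Real.log_le_log h4 h2]

/-- A lower bound for the norm of `halfLogRatio`. The disc is chosen at distance
`t = exp (-p / (α + 2))` from the boundary, which maximizes `(log (1 / t)) ^ p * t ^ (α + 2)`. -/
theorem exists_le_blochBergmanConst {α : ℝ} (hα : -1 < α) : ∃ c : ℝ, 0 < c ∧ ∀ p : ℝ, 0 < p →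
    ENNReal.ofReal (p / (2 * (α + 2)) * (c * Real.exp (-p)) ^ p⁻¹) ≤ blochBergmanConst α p := by
  obtain ⟨c, hc, hb⟩ := exists_le_bergmanMeasure_ball hα
  refine ⟨c, hc, fun p hp => ?_⟩
  have hα2 : 0 < α + 2 := by linarith
  have hd : DifferentiableOn ℂ halfLogRatio (Metric.ball 0 1) := fun z hz =>
    (hasDerivAt_halfLogRatio hz).differentiableAt.differentiableWithinAt
  refine le_trans ?_ (le_iSup₂ (f := fun f (_ : f ∈ {f : ℂ → ℂ |
    DifferentiableOn ℂ f (Metric.ball (0 : ℂ) 1) ∧ blochNorm f ≤ 1}) => bergmanNorm α p f)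
    halfLogRatio ⟨hd, blochNorm_halfLogRatio_le⟩)
  set t := Real.exp (-(p / (α + 2))) with ht_def
  have ht : 0 < t := Real.exp_pos _
  have ht1 : t ≤ 1 := Real.exp_le_one_iff.2 (by rw [neg_nonpos]; positivity)
  have h1 : c * t ^ (α + 2) = c * Real.exp (-p) := by
    rw [ht_def, ← Real.exp_mul]
    congr 2
    field_simp
  have h2 : Real.log (1 / t) / 2 = p / (2 * (α + 2)) := by
    rw [one_div, Real.log_inv, ht_def, Real.log_exp]
    field_simp
  have h3 := hb t ht ht1
  rw [h1] at h3
  set a := p / (2 * (α + 2))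
  have ha : 0 ≤ a := by positivity
  have hp' : ENNReal.ofReal p ≠ 0 := (ENNReal.ofReal_pos.2 hp).ne'
  have hmark := mul_meas_ge_le_pow_eLpNorm (bergmanMeasure α) hp' ENNReal.ofReal_ne_top
    (aestronglyMeasurable_bergmanMeasure α hd.continuousOn) (ENNReal.ofReal a ^ p)
  rw [ENNReal.toReal_ofReal hp.le] at hmark
  have h4 : (ENNReal.ofReal (a * (c * Real.exp (-p)) ^ p⁻¹)) ^ p ≤
      bergmanNorm α p halfLogRatio ^ p := by
    refine le_trans ?_ hmark
    rw [ENNReal.ofReal_mul ha, ENNReal.mul_rpow_of_nonneg _ _ hp.le,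
      ← ENNReal.ofReal_rpow_of_pos (by positivity), ENNReal.rpow_inv_rpow hp.ne']
    refine mul_le_mul_right (h3.trans (measure_mono fun z hz => ?_)) _
    have h5 := le_norm_halfLogRatio ht ht1 hz
    rw [h2] at h5
    refine ENNReal.rpow_le_rpow ?_ hp.le
    rw [← ofReal_norm]
    exact ENNReal.ofReal_le_ofReal h5
  exact (ENNReal.rpow_le_rpow_iff hp).1 h4

theorem le_liminf_blochBergmanConst {α : ℝ} (hα : -1 < α) :
    ENNReal.ofReal (1 / (2 * Real.exp 1 * (α + 2))) ≤
      liminf (fun p : ℝ => blochBergmanConst α p / ENNReal.ofReal p) atTop := by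
  obtain ⟨c, hc, hb⟩ := exists_le_blochBergmanConst hα
  have hα2 : 0 < α + 2 := by linarith
  have hlim : Tendsto (fun p : ℝ => p / (2 * (α + 2)) * (c * Real.exp (-p)) ^ p⁻¹ / p) atTop
      (nhds (1 / (2 * Real.exp 1 * (α + 2)))) := by
    have h1 : Tendsto (fun p : ℝ => c ^ p⁻¹) atTop (nhds 1) := by
      have := (Real.continuousAt_const_rpow (b := 0) hc.ne').tendsto.comp tendsto_inv_atTop_zero
      simpa [Function.comp_def] using this
    have h2 := h1.const_mul (1 / (2 * Real.exp 1 * (α + 2)))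
    rw [mul_one] at h2
    refine h2.congr' ?_
    filter_upwards [eventually_gt_atTop 0] with p hp
    rw [Real.mul_rpow hc.le (Real.exp_pos _).le, ← Real.exp_mul, neg_mul,
      mul_inv_cancel₀ hp.ne', Real.exp_neg]
    field_simp
  have hlim' := (ENNReal.continuous_ofReal.tendsto _).comp hlim
  rw [← hlim'.liminf_eq]
  refine liminf_le_liminf ?_
  filter_upwards [eventually_gt_atTop 0] with p hp
  rw [Function.comp_apply, ENNReal.ofReal_div_of_pos hp]
  gcongr
  exact hb p hp

theorem mainTheorem2 (α : ℝ) (hα : -1 < α) :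
    ENNReal.ofReal (1 / (2 * Real.exp 1 * (α + 2))) ≤
        liminf (fun p : ℝ => blochBergmanConst α p / ENNReal.ofReal p) atTop ∧
      limsup (fun p : ℝ => blochBergmanConst α p / ENNReal.ofReal p) atTop ≤
        ENNReal.ofReal (1 / (2 * Real.exp 1 * Real.sqrt ((α + 1) * (α + 2)))) :=
  ⟨le_liminf_blochBergmanConst hα, limsup_blochBergmanConst_le hα⟩
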